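/- **Setting.** Two bidders $i=1,2$ have value $1$ per click. The vector of click-through rates takes the value $r=(r_1,r_2)\in[0,1]^2$ with probability $p$ and the value $r'=(r_1',r_2')\in[0,1]^2$ with probability $1-p$, where $0<p<1$. An *information structure* is a finitely supported joint distribution $x(\rho,s)$ of click-through rates $\rho$ and signals $s\in[0,1]^2$ whose $\rho$-marginal is this prior. It is *calibrated* if $\mathbb E[\rho_i\mid s_i=t]=t$ for each bidder $i$ and each signal value $t$ of positive probability, i.e. $\sum_{(\rho,s):\,s_i=t}x(\rho,s)(\rho_i-t)=0$ for all $i,t$. Given $(\rho,s)$, the winner is the bidder $i$ with the larger signal (ties are broken uniformly at random), is clicked with probability $\rho_i$, and pays $s_j/s_i$ per click, where $j\neq i$ (a bidder winning with $s_i=0$ pays $0$); the revenue of the information structure is the resulting expected payment. *Full-disclosure* means $s=\rho$ almost surely, *no-disclosure* means $s=\mathbb E[\rho]$ almost surely; these two information structures are called *extremal*, and every other one is called *moderate*. **Theorem (Moderate Information Structures).** Suppose that each bidder's click-through rate is non-degenerate, i.e. $r_1\neq r_1'$ and $r_2\neq r_2'$, and that the two bidders' click-through rates are not identical, i.e. not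 both $r_1=r_2$ and $r_1'=r_2'$. Then there exists a moderate calibrated information structure whose revenue is strictly higher than the revenue of both no-disclosure and full-disclosure. -/

import Mathlib

open Finset

noncomputable section

/-- A vector of click-through rates, or of signals: one real number per bidder. -/
abbrev Profile (n : ℕ) := Fin n → ℝ

/-- A prior over click-through-rate vectors: a finitely supported probability distribution on
`[0, 1]ⁿ`, given by its probability mass function. -/
structure Prior (n : ℕ) where
  mass : Profile n →₀ ℝ
  nonneg : ∀ r, 0 ≤ mass r
  total : (mass.sum fun _ w => w) = 1
  mem_unit : ∀ r, mass r ≠ 0 → ∀ i, r i ∈ Set.Icc (0 : ℝ) 1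

/-- The ex-ante expected click-through rates. -/
def Prior.mean {n : ℕ} (G : Prior n) : Profile n :=
  fun i => G.mass.sum fun r w => w * r i

/-- The prior that puts probability `p` on the profile `r` and `1 - p` on the profile `r'`. -/
def Prior.twoPoint {n : ℕ} (r r' : Profile n) (p : ℝ) (hp : p ∈ Set.Icc (0 : ℝ) 1)
    (hr : ∀ i, r i ∈ Set.Icc (0 : ℝ) 1) (hr' : ∀ i, r' i ∈ Set.Icc (0 : ℝ) 1) : Prior n where
  mass := Finsupp.single r p + Finsupp.single r' (1 - p)
  nonneg := by
    classical
    intro t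
    have h1 : 0 ≤ p := hp.1
    have h2 : 0 ≤ 1 - p := sub_nonneg.mpr hp.2
    simp only [Finsupp.add_apply, Finsupp.single_apply]
    split_ifs <;> linarith
  total := by
    classical
    rw [Finsupp.sum_add_index' (fun _ => rfl) (fun _ _ _ => rfl),
      Finsupp.sum_single_index rfl, Finsupp.sum_single_index rfl]
    ring
  mem_unit := by
    classical
    intro t ht
    by_cases h : r = t
    · exact h ▸ hr
    · by_cases h' : r' = t
      · exact h' ▸ hr'
      · exact absurd (by simp [h, h']) ht

/-- An information structure for the prior `G`: a finitely supported joint distribution of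
click-through rates `r` and signals `s ∈ [0, 1]ⁿ`, given by its mass function on pairs `(r, s)`,
whose marginal on `r` is `G`. -/
structure InfoStructure {n : ℕ} (G : Prior n) where
  mass : (Profile n × Profile n) →₀ ℝ
  nonneg : ∀ z, 0 ≤ mass z
  signal_mem_unit : ∀ z, mass z ≠ 0 → ∀ i, z.2 i ∈ Set.Icc (0 : ℝ) 1
  marginal : mass.mapDomain Prod.fst = G.mass

open Classical in
/-- Calibration, `𝔼[r i | s i = t] = t` for every bidder `i` and every signal value `t`, in its
discrete form: the sum of `x(r, s) (r i - t)` over all `(r, s)` with `s i = t` vanishes. -/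
def InfoStructure.IsCalibrated {n : ℕ} {G : Prior n} (x : InfoStructure G) : Prop :=
  ∀ (i : Fin n) (t : ℝ),
    (x.mass.sum fun z w => if z.2 i = t then w * (z.1 i - t) else 0) = 0

/-- Full disclosure: `s = r` almost surely. -/
def InfoStructure.IsFullDisclosure {n : ℕ} {G : Prior n} (x : InfoStructure G) : Prop :=
  ∀ z, x.mass z ≠ 0 → z.2 = z.1

/-- No disclosure: `s = 𝔼[r]` almost surely. -/
def InfoStructure.IsNoDisclosure {n : ℕ} {G : Prior n} (x : InfoStructure G) : Prop :=
  ∀ z, x.mass z ≠ 0 → z.2 = G.mean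

/-- The extremal information structures are full disclosure and no disclosure. -/
def InfoStructure.IsExtremal {n : ℕ} {G : Prior n} (x : InfoStructure G) : Prop :=
  x.IsFullDisclosure ∨ x.IsNoDisclosure

/-- An information structure is moderate if it is not extremal. -/
def InfoStructure.IsModerate {n : ℕ} {G : Prior n} (x : InfoStructure G) : Prop :=
  ¬ x.IsExtremal

open Classical in
/-- The bidders with the largest score `v i * s i`. -/
def topBidders {n : ℕ} (v s : Profile n) : Finset (Fin n) :=
  univ.filter fun i => ∀ j, v j * s j ≤ v i * s i

/-- The price per click of bidder `i` when `i` wins: the largest `v j * s j / s i`, `j ≠ i`. -/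
def pricePerClick {n : ℕ} (v s : Profile n) (i : Fin n) : ℝ :=
  ⨆ j : {j : Fin n // j ≠ i}, v j * s j / s i

/-- Expected revenue at click-through rates `r` and signals `s`: the winner is drawn uniformly from
the bidders with the largest score (symmetric tie-breaking), is clicked with probability `r i`, and
then pays the price per click. -/
def auctionRevenue {n : ℕ} (v r s : Profile n) : ℝ :=
  (∑ i ∈ topBidders v s, r i * pricePerClick v s i) / ((topBidders v s).card : ℝ)

/-- Expected revenue of the click-through auction with values `v` under the information structure
`x`. -/
def InfoStructure.revenue {n : ℕ} {G : Prior n} (x : InfoStructure G) (v : Profile n) : ℝ :=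
  x.mass.sum fun z w => w * auctionRevenue v z.1 z.2

/-- Sending the signal vector `f r` at the click-through rates `r`. -/
def InfoStructure.ofFun {n : ℕ} (G : Prior n) (f : Profile n → Profile n)
    (hf : ∀ r, G.mass r ≠ 0 → ∀ i, f r i ∈ Set.Icc (0 : ℝ) 1) : InfoStructure G where
  mass := G.mass.mapDomain fun r => (r, f r)
  nonneg := by
    classical
    intro z
    rw [Finsupp.mapDomain, Finsupp.sum_apply]
    refine Finset.sum_nonneg fun r _ => ?_
    simp only [Finsupp.single_apply]
    split_ifs
    · exact G.nonneg r
    · exact le_rfl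
  signal_mem_unit := by
    classical
    intro z hz
    have hz' := Finsupp.mapDomain_support (Finsupp.mem_support_iff.mpr hz)
    obtain ⟨r, hr, rfl⟩ := Finset.mem_image.mp hz'
    exact hf r (Finsupp.mem_support_iff.mp hr)
  marginal := by
    rw [← Finsupp.mapDomain_comp]
    exact Finsupp.mapDomain_id

theorem InfoStructure.ofFun_signal {n : ℕ} (G : Prior n) (f : Profile n → Profile n)
    (hf : ∀ r, G.mass r ≠ 0 → ∀ i, f r i ∈ Set.Icc (0 : ℝ) 1) (z : Profile n × Profile n)
    (hz : (InfoStructure.ofFun G f hf).mass z ≠ 0) : z.2 = f z.1 := by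
  classical
  have hz' := Finsupp.mapDomain_support (Finsupp.mem_support_iff.mpr hz)
  obtain ⟨r, _, rfl⟩ := Finset.mem_image.mp hz'
  rfl

/-- Full disclosure exists for every prior. -/
theorem exists_isFullDisclosure {n : ℕ} (G : Prior n) :
    ∃ x : InfoStructure G, x.IsFullDisclosure :=
  ⟨InfoStructure.ofFun G id G.mem_unit, InfoStructure.ofFun_signal G id G.mem_unit⟩

theorem Prior.mean_mem_unit {n : ℕ} (G : Prior n) (i : Fin n) :
    G.mean i ∈ Set.Icc (0 : ℝ) 1 := by
  constructor
  · exact Finset.sum_nonneg fun r hr =>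
      mul_nonneg (G.nonneg r) (G.mem_unit r (Finsupp.mem_support_iff.mp hr) i).1
  · rw [← G.total]
    exact Finset.sum_le_sum fun r hr =>
      mul_le_of_le_one_right (G.nonneg r) (G.mem_unit r (Finsupp.mem_support_iff.mp hr) i).2

/-- No disclosure exists for every prior. -/
theorem exists_isNoDisclosure {n : ℕ} (G : Prior n) :
    ∃ x : InfoStructure G, x.IsNoDisclosure :=
  ⟨InfoStructure.ofFun G (fun _ => G.mean) fun _ _ => G.mean_mem_unit,
    InfoStructure.ofFun_signal G (fun _ => G.mean) fun _ _ => G.mean_mem_unit⟩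

end

/-! With truthful signals, a winner with positive signal pays the smaller of the two signals in
expectation. Both extremal structures therefore earn at most the mean rate of either bidder, and it
suffices to beat one of the two means.

The competitor structures come from `exists_calibrated_interaction`. Its term `γ x y` has
conditional mean zero given `x` or given `y`, so it moves the joint posterior without touching the
signals. It can thus correlate the true rate of the winner with the price, or with who wins.

If `m j < m i`, bidder `i` is made to win always. With `γ = -η * d j` and small `β > 0`, the gain
over `m j` comes from the covariance of `x` with the reciprocal of the winner's signal. If the means
agree, both signals stay within order `ε` of the common mean, so the price per click tends to one,
while the interaction selects the winner favourably. The limiting gain is `4/9 * η * D ^ 2`, where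
`D = d 0 - d 1` is nonzero because the bidders are not identical. -/

open Filter Topology

/-! ### The two-bidder auction -/

theorem pricePerClick_pair {i j : Fin 2} (hij : i ≠ j) (s : Profile 2) :
    pricePerClick (fun _ => 1) s i = s j / s i := by
  have h : ∀ k : {k : Fin 2 // k ≠ i}, (k : Fin 2) = j := by
    rintro ⟨k, hk⟩
    change k = j
    omega
  have : Nonempty {k : Fin 2 // k ≠ i} := ⟨⟨j, hij.symm⟩⟩
  simp only [pricePerClick, h, one_mul, ciSup_const]

theorem auctionRevenue_of_lt {i j : Fin 2} (r s : Profile 2) (h : s j < s i) :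
    auctionRevenue (fun _ => 1) r s = r i * (s j / s i) := by
  classical
  have hij : i ≠ j := by rintro rfl; exact lt_irrefl _ h
  have htop : topBidders (fun _ => 1) s = {i} := by
    ext k
    simp only [topBidders, mem_filter, mem_univ, true_and, one_mul, mem_singleton]
    constructor
    · intro hk
      by_contra hki
      have : k = j := by omega
      subst this
      exact absurd (hk i) (not_le.mpr h)
    · rintro rfl l
      rcases eq_or_ne l k with rfl | hl
      · exact le_rfl
      · have : l = j := by omega
        subst this
        exact h.le
  simp [auctionRevenue, htop, pricePerClick_pair hij]

/-- The factor `s 0 / s 0` is kept because it is 0, not 1, when both signals vanish. -/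
theorem auctionRevenue_of_eq (r s : Profile 2) (h : s 0 = s 1) :
    auctionRevenue (fun _ => 1) r s = (r 0 + r 1) / 2 * (s 0 / s 0) := by
  classical
  have htop : topBidders (fun _ => 1) s = univ := by
    ext k
    simp only [topBidders, mem_filter, mem_univ, true_and, one_mul, iff_true]
    fin_cases k <;> simp [Fin.forall_fin_two, h]
  simp only [auctionRevenue, htop, Fin.sum_univ_two, card_univ, Fintype.card_fin,
    pricePerClick_pair (show (0 : Fin 2) ≠ 1 by decide),
    pricePerClick_pair (show (1 : Fin 2) ≠ 0 by decide), ← h]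
  push_cast
  ring

/-- Winner and price depend on the signals alone, so only the posterior mean of the rates matters.
-/
theorem auctionRevenue_mix {n : ℕ} (v r r' s : Profile n) (a b : ℝ) :
    auctionRevenue v (fun k => a * r k + b * r' k) s
      = a * auctionRevenue v r s + b * auctionRevenue v r' s := by
  simp only [auctionRevenue, add_mul, sum_add_distrib, mul_assoc, ← mul_sum]
  ring

theorem auctionRevenue_self_le (r : Profile 2) (hr : ∀ i, 0 ≤ r i) (k : Fin 2) :
    auctionRevenue (fun _ => 1) r r ≤ r k := by
  have key : ∀ i j : Fin 2, r j < r i → r i * (r j / r i) ≤ r k := by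
    intro i j h
    rw [mul_div_cancel₀ _ ((hr j).trans_lt h).ne']
    rcases eq_or_ne k i with rfl | hk
    · exact h.le
    · have hij : i ≠ j := by rintro rfl; exact lt_irrefl _ h
      have : k = j := by omega
      subst this
      exact le_rfl
  rcases lt_trichotomy (r 0) (r 1) with h | h | h
  · rw [auctionRevenue_of_lt r r h]; exact key _ _ h
  · rw [auctionRevenue_of_eq r r h, ← h]
    have hk : r k = r 0 := by fin_cases k <;> simp [h]
    rw [hk]
    have := mul_le_mul_of_nonneg_left (div_self_le_one (r 0)) (hr 0)
    linarith
  · rw [auctionRevenue_of_lt r r h]; exact key _ _ h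

/-! ### Extremal information structures -/

theorem InfoStructure.sum_fst {n : ℕ} {G : Prior n} (x : InfoStructure G) (f : Profile n → ℝ) :
    (x.mass.sum fun z w => w * f z.1) = G.mass.sum fun r w => w * f r := by
  rw [← x.marginal, Finsupp.sum_mapDomain_index] <;> intros <;> ring

theorem InfoStructure.mem_unit {n : ℕ} {G : Prior n} (x : InfoStructure G)
    (z : Profile n × Profile n) (hz : x.mass z ≠ 0) (i : Fin n) :
    z.1 i ∈ Set.Icc (0 : ℝ) 1 := by
  classical
  refine G.mem_unit z.1 ?_ i
  rw [← x.marginal, Finsupp.mapDomain, Finsupp.sum_apply]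
  refine (lt_of_lt_of_le ((x.nonneg z).lt_of_ne' hz) ?_).ne'
  have h := Finset.single_le_sum
    (f := fun y => (Finsupp.single y.1 (x.mass y) : Profile n →₀ ℝ) z.1)
    (fun y _ => by
      simp only [Finsupp.single_apply]
      split_ifs
      exacts [x.nonneg y, le_rfl]) (Finsupp.mem_support_iff.mpr hz)
  simpa [Finsupp.sum] using h

theorem InfoStructure.revenue_le_of_isFullDisclosure {G : Prior 2} (x : InfoStructure G)
    (hx : x.IsFullDisclosure) (k : Fin 2) : x.revenue (fun _ => 1) ≤ G.mean k := by
  refine le_trans ?_ (x.sum_fst fun r => r k).le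
  refine Finset.sum_le_sum fun z hz => mul_le_mul_of_nonneg_left ?_ (x.nonneg z)
  have hz' := Finsupp.mem_support_iff.mp hz
  rw [hx z hz']
  exact auctionRevenue_self_le _ (fun i => (x.mem_unit z hz' i).1) k

theorem Prior.sum_auctionRevenue_mean {n : ℕ} (G : Prior n) (v s : Profile n) :
    (G.mass.sum fun r w => w * auctionRevenue v r s) = auctionRevenue v G.mean s := by
  simp only [auctionRevenue, Prior.mean, Finsupp.sum, ← mul_div_assoc, ← Finset.sum_div, mul_sum,
    sum_mul]
  rw [Finset.sum_comm]
  simp only [mul_assoc]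

theorem InfoStructure.revenue_le_of_isNoDisclosure {G : Prior 2} (x : InfoStructure G)
    (hx : x.IsNoDisclosure) (k : Fin 2) : x.revenue (fun _ => 1) ≤ G.mean k := by
  have h : x.revenue (fun _ => 1) = auctionRevenue (fun _ => 1) G.mean G.mean := by
    rw [← G.sum_auctionRevenue_mean, ← x.sum_fst]
    refine Finset.sum_congr rfl fun z hz => ?_
    change _ * _ = _ * _
    rw [hx z (Finsupp.mem_support_iff.mp hz)]
  rw [h]
  exact auctionRevenue_self_le _ (fun i => (G.mean_mem_unit i).1) k

theorem InfoStructure.revenue_le_of_isExtremal {G : Prior 2} (x : InfoStructure G)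
    (hx : x.IsExtremal) (k : Fin 2) : x.revenue (fun _ => 1) ≤ G.mean k :=
  hx.elim (fun h => x.revenue_le_of_isFullDisclosure h k)
    fun h => x.revenue_le_of_isNoDisclosure h k

theorem Prior.twoPoint_mean {n : ℕ} (r r' : Profile n) (p : ℝ) (hp : p ∈ Set.Icc (0 : ℝ) 1)
    (hr : ∀ i, r i ∈ Set.Icc (0 : ℝ) 1) (hr' : ∀ i, r' i ∈ Set.Icc (0 : ℝ) 1) (k : Fin n) :
    (Prior.twoPoint r r' p hp hr hr').mean k = p * r k + (1 - p) * r' k := by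
  classical
  change Finsupp.sum (Finsupp.single r p + Finsupp.single r' (1 - p)) _ = _
  rw [Finsupp.sum_add_index' (fun _ => zero_mul _) (fun _ _ _ => add_mul _ _ _),
    Finsupp.sum_single_index (zero_mul _), Finsupp.sum_single_index (zero_mul _)]

/-! ### A family of calibrated information structures

Bidder `i` observes `x ∈ {2, -1}` and bidder `j` observes `y ∈ {1, -2}`, two independent variables
of mean zero; the posterior probability of the first profile is `p + α x + β y + γ x y`. The
interaction `γ` does not affect the signals. -/

/-- Mass `w` on the signals `s`, with posterior probability `c` for the profile `r`. -/
noncomputable def splitMass (r r' s : Profile 2) (w c : ℝ) : (Profile 2 × Profile 2) →₀ ℝ :=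
  Finsupp.single (r, s) (w * c) + Finsupp.single (r', s) (w * (1 - c))

theorem splitMass_nonneg (r r' s : Profile 2) {w c : ℝ} (hw : 0 ≤ w)
    (hc : c ∈ Set.Icc (0 : ℝ) 1) (z : Profile 2 × Profile 2) : 0 ≤ splitMass r r' s w c z := by
  classical
  have h1 := mul_nonneg hw hc.1
  have h2 := mul_nonneg hw (sub_nonneg.mpr hc.2)
  simp only [splitMass, Finsupp.add_apply, Finsupp.single_apply]
  split_ifs <;> linarith

theorem splitMass_eq_zero (r r' s : Profile 2) (w c : ℝ) {z : Profile 2 × Profile 2}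
    (hz : z.2 ≠ s) : splitMass r r' s w c z = 0 := by
  classical
  have h : ∀ t : Profile 2, (t, s) ≠ z := fun t h => hz (by rw [← h])
  simp [splitMass, h]

theorem splitMass_mapDomain (r r' s : Profile 2) (w c : ℝ) :
    (splitMass r r' s w c).mapDomain Prod.fst
      = Finsupp.single r (w * c) + Finsupp.single r' (w * (1 - c)) := by
  rw [splitMass, Finsupp.mapDomain_add, Finsupp.mapDomain_single, Finsupp.mapDomain_single]

theorem splitMass_sum (r r' s : Profile 2) (w c : ℝ) (f : Profile 2 × Profile 2 → ℝ) :
    ((splitMass r r' s w c).sum fun z a => a * f z)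
      = w * (c * f (r, s) + (1 - c) * f (r', s)) := by
  classical
  rw [splitMass, Finsupp.sum_add_index' (fun _ => zero_mul _) (fun _ _ _ => add_mul _ _ _),
    Finsupp.sum_single_index (zero_mul _), Finsupp.sum_single_index (zero_mul _)]
  ring

/-- Calibration holds because averaging over the other bidder's observation removes both the other
linear term and the interaction. The weights are products of the laws `(1/3, 2/3)` on `(2, -1)` and
`(2/3, 1/3)` on `(1, -2)`. -/
theorem exists_calibrated_interaction (r r' : Profile 2) (p : ℝ) (hp : p ∈ Set.Icc (0 : ℝ) 1)
    (hr : ∀ i, r i ∈ Set.Icc (0 : ℝ) 1) (hr' : ∀ i, r' i ∈ Set.Icc (0 : ℝ) 1) (i : Fin 2)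
    (α β γ : ℝ) (m d : Profile 2) (hm : ∀ k, m k = p * r k + (1 - p) * r' k)
    (hd : ∀ k, d k = r k - r' k) (u : ℝ → ℝ → ℝ)
    (hu : ∀ x y, u x y = α * x + β * y + γ * x * y) (s : ℝ → ℝ → Profile 2)
    (hs : ∀ x y k, s x y k = m k + d k * if k = i then α * x else β * y)
    (hpost : ∀ x ∈ ({2, -1} : Set ℝ), ∀ y ∈ ({1, -2} : Set ℝ), p + u x y ∈ Set.Icc (0 : ℝ) 1)
    (hsig : ∀ x ∈ ({2, -1} : Set ℝ), ∀ y ∈ ({1, -2} : Set ℝ), ∀ k,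
      s x y k ∈ Set.Icc (0 : ℝ) 1) :
    ∃ X : InfoStructure (Prior.twoPoint r r' p hp hr hr'), X.IsCalibrated ∧
      X.revenue (fun _ => 1)
        = 2 / 9 * auctionRevenue (fun _ => 1) (fun k => m k + d k * u 2 1) (s 2 1)
        + 1 / 9 * auctionRevenue (fun _ => 1) (fun k => m k + d k * u 2 (-2)) (s 2 (-2))
        + 4 / 9 * auctionRevenue (fun _ => 1) (fun k => m k + d k * u (-1) 1) (s (-1) 1)
        + 2 / 9 * auctionRevenue (fun _ => 1) (fun k => m k + d k * u (-1) (-2))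
            (s (-1) (-2)) := by
  classical
  simp only [Set.mem_insert_iff, Set.mem_singleton_iff, forall_eq_or_imp, forall_eq]
    at hpost hsig
  obtain ⟨⟨hp1, hp2⟩, hp3, hp4⟩ := hpost
  obtain ⟨⟨hs1, hs2⟩, hs3, hs4⟩ := hsig
  set M := splitMass r r' (s 2 1) (2 / 9) (p + u 2 1)
    + splitMass r r' (s 2 (-2)) (1 / 9) (p + u 2 (-2))
    + splitMass r r' (s (-1) 1) (4 / 9) (p + u (-1) 1)
    + splitMass r r' (s (-1) (-2)) (2 / 9) (p + u (-1) (-2)) with hM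
  have hsum : ∀ f : Profile 2 × Profile 2 → ℝ, (M.sum fun z a => a * f z)
      = 2 / 9 * ((p + u 2 1) * f (r, s 2 1) + (1 - (p + u 2 1)) * f (r', s 2 1))
      + 1 / 9 * ((p + u 2 (-2)) * f (r, s 2 (-2)) + (1 - (p + u 2 (-2))) * f (r', s 2 (-2)))
      + 4 / 9 * ((p + u (-1) 1) * f (r, s (-1) 1) + (1 - (p + u (-1) 1)) * f (r', s (-1) 1))
      + 2 / 9 * ((p + u (-1) (-2)) * f (r, s (-1) (-2))
          + (1 - (p + u (-1) (-2))) * f (r', s (-1) (-2))) := by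
    intro f
    have hz : ∀ z : Profile 2 × Profile 2, (0 : ℝ) * f z = 0 := fun _ => zero_mul _
    have ha : ∀ (z : Profile 2 × Profile 2) (a b : ℝ), (a + b) * f z = a * f z + b * f z :=
      fun _ _ _ => add_mul _ _ _
    rw [hM, Finsupp.sum_add_index' hz ha, Finsupp.sum_add_index' hz ha,
      Finsupp.sum_add_index' hz ha]
    simp only [splitMass_sum]
  refine ⟨⟨M, ?_, ?_, ?_⟩, ?_, ?_⟩
  · intro z
    have h1 := splitMass_nonneg r r' (s 2 1) (w := 2 / 9) (by norm_num) hp1 z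
    have h2 := splitMass_nonneg r r' (s 2 (-2)) (w := 1 / 9) (by norm_num) hp2 z
    have h3 := splitMass_nonneg r r' (s (-1) 1) (w := 4 / 9) (by norm_num) hp3 z
    have h4 := splitMass_nonneg r r' (s (-1) (-2)) (w := 2 / 9) (by norm_num) hp4 z
    simp only [hM, Finsupp.add_apply]
    linarith
  · intro z hz
    by_contra hcon
    have hne : ∀ t : Profile 2, (∀ k, t k ∈ Set.Icc (0 : ℝ) 1) → z.2 ≠ t := by
      rintro t ht rfl
      exact hcon ht
    apply hz
    simp [hM, splitMass_eq_zero _ _ _ _ _ (hne _ hs1), splitMass_eq_zero _ _ _ _ _ (hne _ hs2),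
      splitMass_eq_zero _ _ _ _ _ (hne _ hs3), splitMass_eq_zero _ _ _ _ _ (hne _ hs4)]
  · change _ = Finsupp.single r p + Finsupp.single r' (1 - p)
    simp only [hM, Finsupp.mapDomain_add, splitMass_mapDomain]
    ext t
    simp only [Finsupp.add_apply, Finsupp.single_apply, hu]
    split_ifs <;> ring
  · intro k t
    have hform : ∀ (z : Profile 2 × Profile 2) (w : ℝ), (if z.2 k = t then w * (z.1 k - t) else 0)
        = w * if z.2 k = t then z.1 k - t else 0 := fun z w => by rw [mul_ite, mul_zero]
    simp only [hform]
    rw [hsum]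
    simp only [hs, hu, hm, hd]
    by_cases hk : k = i
    · simp only [if_pos hk]
      -- The two signal values may coincide, so any subset of them can equal `t`; the coefficients
      -- below are their probabilities.
      split_ifs with h1 h2 h2
      · linear_combination (1 / 3) * h1 + (2 / 3) * h2
      · linear_combination (1 / 3) * h1
      · linear_combination (2 / 3) * h2
      · ring
    · simp only [if_neg hk]
      split_ifs with h1 h2 h2
      · linear_combination (2 / 3) * h1 + (1 / 3) * h2
      · linear_combination (2 / 3) * h1
      · linear_combination (1 / 3) * h2
      · ring
  · refine (hsum fun z => auctionRevenue (fun _ => 1) z.1 z.2).trans ?_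
    have hmix : ∀ x y, (fun k => m k + d k * u x y)
        = fun k => (p + u x y) * r k + (1 - (p + u x y)) * r' k := by
      intro x y
      funext k
      rw [hm, hd]
      ring
    simp only [hmix, auctionRevenue_mix]

/-! ### Strict gains over the smaller mean -/

/-- When the expected click-through rates differ, bidder `i` always wins, and an interaction that
dominates the signal of bidder `j` raises the revenue. -/
theorem exists_calibrated_mean_lt_of_mean_lt (r r' : Profile 2) (p : ℝ)
    (hp : p ∈ Set.Ioo (0 : ℝ) 1)
    (hr : ∀ i, r i ∈ Set.Icc (0 : ℝ) 1) (hr' : ∀ i, r' i ∈ Set.Icc (0 : ℝ) 1)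
    (hrandom : ∀ i, r i ≠ r' i) {i j : Fin 2} (m : Profile 2)
    (hm : ∀ k, m k = p * r k + (1 - p) * r' k)
    (hm01 : ∀ k, m k ∈ Set.Ioo (0 : ℝ) 1) (hlt : m j < m i) :
    ∃ X : InfoStructure (Prior.twoPoint r r' p (Set.Ioo_subset_Icc_self hp) hr hr'),
      X.IsCalibrated ∧ m j < X.revenue (fun _ => 1) := by
  have hij : j ≠ i := by rintro rfl; exact lt_irrefl _ hlt
  obtain ⟨d, hd⟩ : ∃ d : Profile 2, ∀ k, d k = r k - r' k := ⟨_, fun _ => rfl⟩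
  have hd0 : ∀ k, d k ≠ 0 := fun k => by rw [hd]; exact sub_ne_zero.mpr (hrandom k)
  have ev : ∀ (g : ℝ → ℝ) (a b : ℝ), Continuous g → g 0 ∈ Set.Ioo a b →
      ∀ᶠ e in 𝓝[>] (0 : ℝ), g e ∈ Set.Ioo a b := fun g a b hg h0 =>
    (hg.continuousAt.eventually (isOpen_Ioo.mem_nhds h0)).filter_mono nhdsWithin_le_nhds
  obtain ⟨hp0, hp1⟩ := hp
  have hmi := hm01 i
  have hmj := hm01 j
  -- `η` is fixed first, with strict constraints at `β = 0`; these survive for small `β`.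
  obtain ⟨η, hη, a1, a2, a3, a4, b1, b2⟩ : ∃ η : ℝ, 0 < η ∧
      p + (η * 2 + (-η * d j) * 2 * 1) ∈ Set.Ioo (0 : ℝ) 1 ∧
      p + (η * 2 + (-η * d j) * 2 * (-2)) ∈ Set.Ioo (0 : ℝ) 1 ∧
      p + (η * (-1) + (-η * d j) * (-1) * 1) ∈ Set.Ioo (0 : ℝ) 1 ∧
      p + (η * (-1) + (-η * d j) * (-1) * (-2)) ∈ Set.Ioo (0 : ℝ) 1 ∧
      m i + d i * (η * 2) ∈ Set.Ioo (m j) 1 ∧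
      m i + d i * (η * (-1)) ∈ Set.Ioo (m j) 1 := by
    refine Eventually.exists (f := 𝓝[>] (0 : ℝ)) ?_
    refine (eventually_mem_nhdsWithin).and ?_
    refine (ev _ _ _ (by fun_prop) ?_).and <| (ev _ _ _ (by fun_prop) ?_).and <|
      (ev _ _ _ (by fun_prop) ?_).and <| (ev _ _ _ (by fun_prop) ?_).and <|
      (ev _ _ _ (by fun_prop) ?_).and <| ev _ _ _ (by fun_prop) ?_
    all_goals simp [hp0, hp1, hlt, hmi.2]
  set S := m i + d i * (η * 2) with hS
  set T := m i + d i * (η * (-1)) with hT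
  -- Since `y` has mean 0 and second moment 2, the gain over `m j` is `2 * β / (S * T)` times `d i *
  -- d j * (β * (m i + η * d i) - 2 * γ * (η * d i))`. The choice `γ = -η * d j` makes this last
  -- factor positive at `β = 0`.
  have hgain : (0 : ℝ) < d i * d j * (0 * (m i + η * d i) - 2 * (-η * d j) * (η * d i)) := by
    have h1 := mul_self_pos.mpr (mul_ne_zero (hd0 i) (hd0 j))
    have : d i * d j * (0 * (m i + η * d i) - 2 * (-η * d j) * (η * d i))
        = 2 * (η * η) * (d i * d j * (d i * d j)) := by ring
    rw [this]
    positivity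
  obtain ⟨β, hβ, c1, c2, c3, c4, e1, e2, f1, f2, f3, f4, hg⟩ : ∃ β : ℝ, 0 < β ∧
      p + (η * 2 + β * 1 + (-η * d j) * 2 * 1) ∈ Set.Ioo (0 : ℝ) 1 ∧
      p + (η * 2 + β * (-2) + (-η * d j) * 2 * (-2)) ∈ Set.Ioo (0 : ℝ) 1 ∧
      p + (η * (-1) + β * 1 + (-η * d j) * (-1) * 1) ∈ Set.Ioo (0 : ℝ) 1 ∧
      p + (η * (-1) + β * (-2) + (-η * d j) * (-1) * (-2)) ∈ Set.Ioo (0 : ℝ) 1 ∧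
      m j + d j * (β * 1) ∈ Set.Ioo (0 : ℝ) 1 ∧
      m j + d j * (β * (-2)) ∈ Set.Ioo (0 : ℝ) 1 ∧
      -- Only the upper bounds `S` and `T` matter; `-1` here, and the upper end `… + 1` in the last
      -- condition, merely complete the open intervals.
      m j + d j * (β * 1) ∈ Set.Ioo (-1) S ∧
      m j + d j * (β * (-2)) ∈ Set.Ioo (-1) S ∧
      m j + d j * (β * 1) ∈ Set.Ioo (-1) T ∧
      m j + d j * (β * (-2)) ∈ Set.Ioo (-1) T ∧
      d i * d j * (β * (m i + η * d i) - 2 * (-η * d j) * (η * d i)) ∈ Set.Ioo 0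
        (d i * d j * (0 * (m i + η * d i) - 2 * (-η * d j) * (η * d i)) + 1) := by
    refine Eventually.exists (f := 𝓝[>] (0 : ℝ)) ?_
    refine (eventually_mem_nhdsWithin).and ?_
    have hj1 : -1 < m j := by linarith [hmj.1]
    refine (ev _ _ _ (by fun_prop) ?_).and <| (ev _ _ _ (by fun_prop) ?_).and <|
      (ev _ _ _ (by fun_prop) ?_).and <| (ev _ _ _ (by fun_prop) ?_).and <|
      (ev _ _ _ (by fun_prop) ?_).and <| (ev _ _ _ (by fun_prop) ?_).and <|
      (ev _ _ _ (by fun_prop) ?_).and <| (ev _ _ _ (by fun_prop) ?_).and <|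
      (ev _ _ _ (by fun_prop) ?_).and <| (ev _ _ _ (by fun_prop) ?_).and <|
      ev _ _ _ (by fun_prop) ?_
    · simpa using a1
    · simpa using a2
    · simpa using a3
    · simpa using a4
    · simpa using hmj
    · simpa using hmj
    · simpa [hj1] using b1.1
    · simpa [hj1] using b1.1
    · simpa [hj1] using b2.1
    · simpa [hj1] using b2.1
    · exact ⟨hgain, by linarith⟩
  have hS0 : 0 < S := hmj.1.trans b1.1
  have hT0 : 0 < T := hmj.1.trans b2.1
  have hk : ∀ k, k = i ∨ k = j := fun k => by omega
  obtain ⟨X, hX, hrev⟩ := exists_calibrated_interaction r r' p ⟨hp0.le, hp1.le⟩ hr hr' i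
    η β (-η * d j) m d hm hd _ (fun _ _ => rfl)
    (fun x y k => m k + d k * if k = i then η * x else β * y) (fun _ _ _ => rfl)
    (by
      simp only [Set.mem_insert_iff, Set.mem_singleton_iff, forall_eq_or_imp, forall_eq]
      exact ⟨⟨Set.Ioo_subset_Icc_self c1, Set.Ioo_subset_Icc_self c2⟩,
        Set.Ioo_subset_Icc_self c3, Set.Ioo_subset_Icc_self c4⟩)
    (by
      have hi1 : S ∈ Set.Icc (0 : ℝ) 1 := ⟨hS0.le, b1.2.le⟩
      have hi2 : T ∈ Set.Icc (0 : ℝ) 1 := ⟨hT0.le, b2.2.le⟩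
      have hj1 := Set.Ioo_subset_Icc_self e1
      have hj2 := Set.Ioo_subset_Icc_self e2
      simp only [Set.mem_insert_iff, Set.mem_singleton_iff, forall_eq_or_imp, forall_eq]
      refine ⟨⟨?_, ?_⟩, ?_, ?_⟩ <;> intro k <;> rcases hk k with rfl | rfl <;>
        simp only [if_true, if_neg hij] <;> assumption)
  refine ⟨X, hX, ?_⟩
  rw [hrev]
  rw [auctionRevenue_of_lt (i := i) (j := j) _ _ (by simpa only [if_true, if_neg hij] using f1.2),
    auctionRevenue_of_lt (i := i) (j := j) _ _ (by simpa only [if_true, if_neg hij] using f2.2),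
    auctionRevenue_of_lt (i := i) (j := j) _ _ (by simpa only [if_true, if_neg hij] using f3.2),
    auctionRevenue_of_lt (i := i) (j := j) _ _ (by simpa only [if_true, if_neg hij] using f4.2)]
  simp only [if_true, if_neg hij]
  rw [← hS, ← hT, ← sub_pos]
  have hid : ∀ A B C D E F G H : ℝ, 2 / 9 * (A * (E / S)) + 1 / 9 * (B * (F / S))
      + 4 / 9 * (C * (G / T)) + 2 / 9 * (D * (H / T)) - m j
      = (T * (2 / 9 * (A * E) + 1 / 9 * (B * F)) + S * (4 / 9 * (C * G) + 2 / 9 * (D * H))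
        - m j * (S * T)) / (S * T) := by
    intros
    field_simp
    ring
  rw [hid]
  refine div_pos ?_ (mul_pos hS0 hT0)
  have hfin := mul_pos hβ hg.1
  rw [hS, hT]
  nlinarith only [hfin]

/-- When the expected click-through rates agree, the interaction correlates the winner with the
profile at a price per click close to one. -/
theorem exists_calibrated_mean_lt_of_mean_eq (r r' : Profile 2) (p : ℝ)
    (hp : p ∈ Set.Ioo (0 : ℝ) 1)
    (hr : ∀ i, r i ∈ Set.Icc (0 : ℝ) 1) (hr' : ∀ i, r' i ∈ Set.Icc (0 : ℝ) 1)
    (hrandom : ∀ i, r i ≠ r' i) (hdistinct : ¬ (r 0 = r 1 ∧ r' 0 = r' 1)) (m : Profile 2)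
    (hm : ∀ k, m k = p * r k + (1 - p) * r' k)
    (hm01 : ∀ k, m k ∈ Set.Ioo (0 : ℝ) 1) (heq : m 0 = m 1) :
    ∃ X : InfoStructure (Prior.twoPoint r r' p (Set.Ioo_subset_Icc_self hp) hr hr'),
      X.IsCalibrated ∧ m 0 < X.revenue (fun _ => 1) := by
  obtain ⟨d, hd⟩ : ∃ d : Profile 2, ∀ k, d k = r k - r' k := ⟨_, fun _ => rfl⟩
  have hd0 : ∀ k, d k ≠ 0 := fun k => by rw [hd]; exact sub_ne_zero.mpr (hrandom k)
  -- Equal means and equal differences would force identical profiles.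
  have hdd : d 0 - d 1 ≠ 0 := by
    intro h
    have h0 := hm 0
    have h1 := hm 1
    rw [hd, hd] at h
    refine hdistinct ⟨?_, ?_⟩
    · linear_combination heq - h0 + h1 + (1 - p) * h
    · linear_combination heq - h0 + h1 - p * h
  have ev : ∀ (g : ℝ → ℝ) (a b : ℝ), Continuous g → g 0 ∈ Set.Ioo a b →
      ∀ᶠ e in 𝓝[>] (0 : ℝ), g e ∈ Set.Ioo a b := fun g a b hg h0 =>
    (hg.continuousAt.eventually (isOpen_Ioo.mem_nhds h0)).filter_mono nhdsWithin_le_nhds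
  obtain ⟨hp0, hp1⟩ := hp
  obtain ⟨hm0, hm1⟩ := hm01 0
  set D := d 0 - d 1 with hD
  obtain ⟨η, hη, a1, a2, a3, a4⟩ : ∃ η : ℝ, 0 < η ∧
      p + (η * D) * 2 * 1 ∈ Set.Ioo (0 : ℝ) 1 ∧
      p + (η * D) * 2 * (-2) ∈ Set.Ioo (0 : ℝ) 1 ∧
      p + (η * D) * (-1) * 1 ∈ Set.Ioo (0 : ℝ) 1 ∧
      p + (η * D) * (-1) * (-2) ∈ Set.Ioo (0 : ℝ) 1 := by
    refine Eventually.exists (f := 𝓝[>] (0 : ℝ)) ?_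
    refine (eventually_mem_nhdsWithin).and ?_
    refine (ev _ _ _ (by fun_prop) ?_).and <| (ev _ _ _ (by fun_prop) ?_).and <|
      (ev _ _ _ (by fun_prop) ?_).and <| ev _ _ _ (by fun_prop) ?_
    all_goals simp [hp0, hp1]
  set γ := η * D with hγ
  -- Dividing by `d 0` and `d 1` turns the signals into `m 0 + ε * x` and `m 0 + ε * y`. The values
  -- of `x` and `y` are disjoint, so no ties occur, and bidder 1 wins only at `(-1, 1)`.
  set u : ℝ → ℝ → ℝ → ℝ := fun ε x y => ε / d 0 * x + ε / d 1 * y + γ * x * y with hu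
  have hucont : ∀ x y, Continuous fun ε => u ε x y := fun x y => by
    simp only [hu]; fun_prop
  have hu0 : ∀ x y, u 0 x y = γ * x * y := fun x y => by simp [hu]
  set R : ℝ → ℝ := fun ε =>
    2 / 9 * ((m 0 + d 0 * u ε 2 1) * ((m 0 + ε) / (m 0 + 2 * ε)))
    + 1 / 9 * ((m 0 + d 0 * u ε 2 (-2)) * ((m 0 - 2 * ε) / (m 0 + 2 * ε)))
    + 4 / 9 * ((m 0 + d 1 * u ε (-1) 1) * ((m 0 - ε) / (m 0 + ε)))
    + 2 / 9 * ((m 0 + d 0 * u ε (-1) (-2)) * ((m 0 - 2 * ε) / (m 0 - ε))) with hR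
  have hRcont : ContinuousAt R 0 := by
    have h1 := fun x y => (hucont x y).continuousAt (x := 0)
    have q1 : ContinuousAt (fun ε : ℝ => (m 0 + ε) / (m 0 + 2 * ε)) 0 :=
      ContinuousAt.div (by fun_prop) (by fun_prop) (by simpa using hm0.ne')
    have q2 : ContinuousAt (fun ε : ℝ => (m 0 - 2 * ε) / (m 0 + 2 * ε)) 0 :=
      ContinuousAt.div (by fun_prop) (by fun_prop) (by simpa using hm0.ne')
    have q3 : ContinuousAt (fun ε : ℝ => (m 0 - ε) / (m 0 + ε)) 0 :=
      ContinuousAt.div (by fun_prop) (by fun_prop) (by simpa using hm0.ne')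
    have q4 : ContinuousAt (fun ε : ℝ => (m 0 - 2 * ε) / (m 0 - ε)) 0 :=
      ContinuousAt.div (by fun_prop) (by fun_prop) (by simpa using hm0.ne')
    have l : ∀ k x y, ContinuousAt (fun ε => m 0 + d k * u ε x y) 0 := fun k x y =>
      continuousAt_const.add (continuousAt_const.mul (h1 x y))
    exact (((continuousAt_const.mul ((l 0 2 1).mul q1)).add
      (continuousAt_const.mul ((l 0 2 (-2)).mul q2))).add
      (continuousAt_const.mul ((l 1 (-1) 1).mul q3))).add
      (continuousAt_const.mul ((l 0 (-1) (-2)).mul q4))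
  -- At `ε = 0` all price ratios are 1, and the terms in `γ` sum to `4/9 * γ * (d 0 - d 1)`.
  have hR0 : m 0 < R 0 := by
    have hq : m 0 / m 0 = 1 := div_self hm0.ne'
    simp only [hR, hu0, mul_zero, add_zero, sub_zero, hq, hγ]
    have := mul_pos hη (mul_self_pos.mpr hdd)
    rw [hD] at this ⊢
    nlinarith only [this]
  obtain ⟨ε, hε, c1, c2, c3, c4, e1, e2, e3, e4, hg⟩ : ∃ ε : ℝ, 0 < ε ∧
      p + u ε 2 1 ∈ Set.Ioo (0 : ℝ) 1 ∧
      p + u ε 2 (-2) ∈ Set.Ioo (0 : ℝ) 1 ∧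
      p + u ε (-1) 1 ∈ Set.Ioo (0 : ℝ) 1 ∧
      p + u ε (-1) (-2) ∈ Set.Ioo (0 : ℝ) 1 ∧
      m 0 + 2 * ε ∈ Set.Ioo (0 : ℝ) 1 ∧
      m 0 + ε ∈ Set.Ioo (0 : ℝ) 1 ∧
      m 0 - ε ∈ Set.Ioo (0 : ℝ) 1 ∧
      m 0 - 2 * ε ∈ Set.Ioo (0 : ℝ) 1 ∧ m 0 < R ε := by
    refine Eventually.exists (f := 𝓝[>] (0 : ℝ)) ?_
    refine (eventually_mem_nhdsWithin).and ?_
    refine (ev _ _ _ (continuous_const.add (hucont _ _)) ?_).and <|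
      (ev _ _ _ (continuous_const.add (hucont _ _)) ?_).and <|
      (ev _ _ _ (continuous_const.add (hucont _ _)) ?_).and <|
      (ev _ _ _ (continuous_const.add (hucont _ _)) ?_).and <|
      (ev _ _ _ (by fun_prop) ?_).and <| (ev _ _ _ (by fun_prop) ?_).and <|
      (ev _ _ _ (by fun_prop) ?_).and <| (ev _ _ _ (by fun_prop) ?_).and <|
      (hRcont.eventually (lt_mem_nhds hR0)).filter_mono nhdsWithin_le_nhds
    · simpa only [Pi.add_apply, hu0] using a1
    · simpa only [Pi.add_apply, hu0] using a2
    · simpa only [Pi.add_apply, hu0] using a3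
    · simpa only [Pi.add_apply, hu0] using a4
    all_goals simp [hm0, hm1]
  have hs0 : ∀ x, d 0 * (ε / d 0 * x) = ε * x := fun x => by
    have := hd0 0
    field_simp
  have hs1 : ∀ y, d 1 * (ε / d 1 * y) = ε * y := fun y => by
    have := hd0 1
    field_simp
  obtain ⟨s, hs⟩ : ∃ s : ℝ → ℝ → Profile 2, ∀ x y k,
      s x y k = m k + d k * if k = 0 then ε / d 0 * x else ε / d 1 * y :=
    ⟨_, fun _ _ _ => rfl⟩
  have hsi : ∀ x y, s x y 0 = m 0 + ε * x := fun x y => by rw [hs, if_pos rfl, hs0]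
  have hsj : ∀ x y, s x y 1 = m 0 + ε * y := fun x y => by
    rw [hs, if_neg (by decide), hs1, heq]
  obtain ⟨X, hX, hrev⟩ := exists_calibrated_interaction r r' p ⟨hp0.le, hp1.le⟩ hr hr' 0
    (ε / d 0) (ε / d 1) γ m d hm hd (u ε) (fun _ _ => rfl) s hs
    (by
      simp only [Set.mem_insert_iff, Set.mem_singleton_iff, forall_eq_or_imp, forall_eq]
      exact ⟨⟨Set.Ioo_subset_Icc_self c1, Set.Ioo_subset_Icc_self c2⟩,
        Set.Ioo_subset_Icc_self c3, Set.Ioo_subset_Icc_self c4⟩)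
    (by
      obtain ⟨-, e1⟩ := e1
      obtain ⟨e4, -⟩ := e4
      simp only [Set.mem_insert_iff, Set.mem_singleton_iff, forall_eq_or_imp, forall_eq,
        Fin.forall_fin_two, hsi, hsj, Set.mem_Icc]
      refine ⟨⟨⟨⟨?_, ?_⟩, ?_, ?_⟩, ⟨?_, ?_⟩, ?_, ?_⟩, ⟨⟨?_, ?_⟩, ?_, ?_⟩, ⟨?_, ?_⟩, ?_, ?_⟩ <;>
        linarith)
  refine ⟨X, hX, hg.trans_eq ?_⟩
  rw [hrev]
  rw [auctionRevenue_of_lt (i := 0) (j := 1) _ (s 2 1) (by rw [hsi, hsj]; linarith),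
    auctionRevenue_of_lt (i := 0) (j := 1) _ (s 2 (-2)) (by rw [hsi, hsj]; linarith),
    auctionRevenue_of_lt (i := 1) (j := 0) _ (s (-1) 1) (by rw [hsi, hsj]; linarith),
    auctionRevenue_of_lt (i := 0) (j := 1) _ (s (-1) (-2)) (by rw [hsi, hsj]; linarith)]
  simp only [hsi, hsj, hR, ← heq]
  ring_nf

/-! ### Conclusion for the two-point prior -/

theorem mean_mem_Ioo {p a b : ℝ} (hp : p ∈ Set.Ioo (0 : ℝ) 1) (ha : a ∈ Set.Icc (0 : ℝ) 1)
    (hb : b ∈ Set.Icc (0 : ℝ) 1) (hab : a ≠ b) : p * a + (1 - p) * b ∈ Set.Ioo (0 : ℝ) 1 := by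
  obtain ⟨h0, h1⟩ := hp
  obtain ⟨ha0, ha1⟩ := ha
  obtain ⟨hb0, hb1⟩ := hb
  rcases lt_or_gt_of_ne hab with h | h <;> constructor <;> nlinarith

theorem mainTheorem3 (r r' : Profile 2) (p : ℝ) (hp : p ∈ Set.Ioo (0 : ℝ) 1)
    (hr : ∀ i, r i ∈ Set.Icc (0 : ℝ) 1) (hr' : ∀ i, r' i ∈ Set.Icc (0 : ℝ) 1)
    (hrandom : ∀ i, r i ≠ r' i)
    (hdistinct : ¬ (r 0 = r 1 ∧ r' 0 = r' 1)) :
    ∃ x : InfoStructure (Prior.twoPoint r r' p (Set.Ioo_subset_Icc_self hp) hr hr'),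
      x.IsCalibrated ∧ x.IsModerate ∧
        ∀ y : InfoStructure (Prior.twoPoint r r' p (Set.Ioo_subset_Icc_self hp) hr hr'),
          y.IsExtremal → y.revenue (fun _ => 1) < x.revenue (fun _ => 1) := by
  obtain ⟨m, hm⟩ : ∃ m : Profile 2, ∀ k, m k = p * r k + (1 - p) * r' k := ⟨_, fun _ => rfl⟩
  have hm01 : ∀ k, m k ∈ Set.Ioo (0 : ℝ) 1 := fun k => by
    rw [hm]
    exact mean_mem_Ioo hp (hr k) (hr' k) (hrandom k)
  obtain ⟨X, hX, k, hk⟩ : ∃ X : InfoStructure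
      (Prior.twoPoint r r' p (Set.Ioo_subset_Icc_self hp) hr hr'),
      X.IsCalibrated ∧ ∃ k, m k < X.revenue (fun _ => 1) := by
    rcases lt_trichotomy (m 0) (m 1) with h | h | h
    · obtain ⟨X, hX, hlt⟩ := exists_calibrated_mean_lt_of_mean_lt r r' p hp hr hr' hrandom m hm
        hm01 h
      exact ⟨X, hX, 0, hlt⟩
    · obtain ⟨X, hX, hlt⟩ := exists_calibrated_mean_lt_of_mean_eq r r' p hp hr hr' hrandom
        hdistinct m hm hm01 h
      exact ⟨X, hX, 0, hlt⟩
    · obtain ⟨X, hX, hlt⟩ := exists_calibrated_mean_lt_of_mean_lt r r' p hp hr hr' hrandom m hm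
        hm01 h
      exact ⟨X, hX, 1, hlt⟩
  have hbeats : ∀ y : InfoStructure (Prior.twoPoint r r' p (Set.Ioo_subset_Icc_self hp) hr hr'),
      y.IsExtremal → y.revenue (fun _ => 1) < X.revenue (fun _ => 1) := fun y hy => by
    refine (y.revenue_le_of_isExtremal hy k).trans_lt ?_
    rw [Prior.twoPoint_mean, ← hm]
    exact hk
  -- Moderateness is automatic: an extremal `X` would have to beat itself.
  exact ⟨X, hX, fun h => lt_irrefl _ (hbeats X h), hbeats⟩
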